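/- Let $A$ be a finite alphabet with at least two symbols. A \emph{tree} over $A$ is a set $\tau$ of finite strings and left-infinite sequences over $A$ such that no element of $\tau$ is a proper suffix of another; it is \emph{irreducible} if no element can be replaced by one of its proper suffixes without violating this property. Let $\bar\tau$ be the set of all finite suffixes of elements of $\tau$, and write $\tau\preceq\tau'$ (respectively $\tau\prec\tau'$) if $\bar\tau\subseteq\bar\tau'$ (respectively $\bar\tau\subsetneq\bar\tau'$). Let $\tau^\infty$ be the tree of all left-infinite sequences over $A$. Let $\mathcal P$ be the set of all stationary ergodic probability measures on $A^{\mathbb Z}$, with coordinate process $(X_i)_{i\in\mathbb Z}$. For $P\in\mathcal P$, say that a finite string $s$ is \emph{sufficient} if $P(X_0=a\mid X_{-|v|}^{-1}=v)=P(X_0=a\mid X_{-|s|}^{-1}=s)$ for every $a\in A$ and every finite string $v$ that has $s$ as a suffix and satisfies $P(X_{-|v|}^{-1}=v)>0$. A finite string is a \emph{context} of $P$ if it has positive probability, is sufficient, and has no sufficient proper suffix; a left-infinite sequence is an \emph{infinite context} of $P$ if all its finite suffixes (including the empty one) have positive probability and none of them is a context. The \emph{context tree} $\tau_P$ is the set of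 all contexts and infinite contexts of $P$. Let $\mathcal P_f\subset\mathcal P$ be the set of those $P$ for which $\tau_P$ is finite. Let $n\ge 0$ and let $U_n$ be any function from $A^n$ to the set of irreducible trees over $A$, evaluated at the sample $(X_1,\dots,X_n)$. If $$\sup_{P\in\mathcal P}P(U_n\prec\tau^\infty)=1,$$ then $$\inf_{P\in\mathcal P}P(\tau_P\preceq U_n)=0\qquad\text{and}\qquad \inf_{P\in\mathcal P_f}P(\tau_P\preceq U_n)=0.$$ -/

import Mathlib

open MeasureTheory ProbabilityTheory

namespace CT

/-- A leaf over the alphabet `A`: a finite string, written from left to right, or a left-infinite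
sequence `x`, whose symbol at position `-(i + 1)` is `x i`. -/
inductive Leaf (A : Type*) where
  | str (w : List A) : Leaf A
  | seq (x : ℕ → A) : Leaf A

section Trees

variable {A : Type*}

/-- The suffix `x_{-k} … x_{-1}` of length `k` of a left-infinite sequence. -/
def lastSymbols (x : ℕ → A) (k : ℕ) : List A := ((List.range k).map x).reverse

/-- The finite string `u` is a suffix of the leaf `s` (possibly `s` itself). -/
def IsSuffixOf (u : List A) : Leaf A → Prop
  | .str w => u <:+ w
  | .seq x => u = lastSymbols x u.length

/-- The finite string `u` is a proper suffix of the leaf `s`. A left-infinite sequence is never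
a proper suffix of anything, so only finite strings have to be considered. -/
def IsProperSuffixOf (u : List A) (s : Leaf A) : Prop :=
  IsSuffixOf u s ∧ s ≠ .str u

/-- A tree is a set of leaves none of which is a proper suffix of another. -/
def IsTree (τ : Set (Leaf A)) : Prop :=
  ∀ u : List A, .str u ∈ τ → ∀ s ∈ τ, ¬ IsProperSuffixOf u s

/-- A tree is irreducible if replacing a leaf by one of its proper suffixes never gives a tree. -/
def IsIrreducible (τ : Set (Leaf A)) : Prop :=
  ∀ w ∈ τ, ∀ u : List A, IsProperSuffixOf u w → ¬ IsTree ((τ \ {w}) ∪ {.str u})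

/-- The nodes of `τ`: all finite suffixes of leaves of `τ`. -/
def nodes (τ : Set (Leaf A)) : Set (List A) := {u | ∃ s ∈ τ, IsSuffixOf u s}

/-- `τ ⪯ τ'`. -/
def TreeLE (τ τ' : Set (Leaf A)) : Prop := nodes τ ⊆ nodes τ'

/-- `τ ≺ τ'`. -/
def TreeLT (τ τ' : Set (Leaf A)) : Prop := nodes τ ⊂ nodes τ'

end Trees

/-- The set of all irreducible trees over `A`. -/
structure IrredTree (A : Type*) where
  leaves : Set (Leaf A)
  isTree : IsTree leaves
  irreducible : IsIrreducible leaves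

/-- The tree `τ^∞` of all left-infinite sequences. -/
def fullTree (A : Type*) : Set (Leaf A) := Set.range Leaf.seq

section Processes

variable {A : Type*}

/-- The left shift on two-sided sequences. -/
def shift (ω : ℤ → A) : ℤ → A := fun i => ω (i + 1)

/-- The event `X_{-|s|} … X_{-1} = s`. -/
def pastEvent (s : List A) : Set (ℤ → A) :=
  {ω | ∀ i : Fin s.length, ω ((i : ℤ) - s.length) = s.get i}

/-- The sample `(X_1, …, X_n)`. -/
def sample (n : ℕ) (ω : ℤ → A) : Fin n → A := fun i => ω ((i : ℤ) + 1)

variable [MeasurableSpace A]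

/-- `P(a | s) = Prob(X_0 = a | X_{-|s|} … X_{-1} = s)`, used only when `P(s) > 0`. -/
noncomputable def transProb (P : Measure (ℤ → A)) (s : List A) (a : A) : ENNReal :=
  cond P (pastEvent s) {ω | ω 0 = a}

/-- The string `s` determines the law of the next symbol: every extension of `s` to the left that
has positive probability has the same transition probabilities as `s`. -/
def DeterminesNext (P : Measure (ℤ → A)) (s : List A) : Prop :=
  ∀ a : A, ∀ v : List A, s <:+ v → 0 < P (pastEvent v) → transProb P v a = transProb P s a

/-- Finite contexts. -/
def IsContext (P : Measure (ℤ → A)) (s : List A) : Prop :=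
  (0 < P (pastEvent s) ∨ s = []) ∧ DeterminesNext P s ∧
    ∀ u : List A, u <:+ s → u ≠ s → ¬ DeterminesNext P u

/-- Infinite contexts: all finite suffixes have positive probability, none is a context. -/
def IsInfiniteContext (P : Measure (ℤ → A)) (x : ℕ → A) : Prop :=
  ∀ k : ℕ, 0 < P (pastEvent (lastSymbols x k)) ∧ ¬ IsContext P (lastSymbols x k)

/-- The context tree `τ_P`: the set of all finite and infinite contexts. -/
def contextTree (P : Measure (ℤ → A)) : Set (Leaf A) :=
  {l | (∃ s, l = .str s ∧ IsContext P s) ∨ (∃ x, l = .seq x ∧ IsInfiniteContext P x)}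

end Processes

/-- The set of all stationary ergodic probability measures on `A^ℤ`. -/
def statErgodic (A : Type*) [MeasurableSpace A] : Set (Measure (ℤ → A)) :=
  {P | IsProbabilityMeasure P ∧ Ergodic shift P}

/-- The stationary ergodic probability measures with finite context tree. -/
def statErgodicFinite (A : Type*) [MeasurableSpace A] : Set (Measure (ℤ → A)) :=
  {P | P ∈ statErgodic A ∧ (contextTree P).Finite}

end CT

/-! The sample takes finitely many values, and every value for which `U` lies strictly below the
full tree yields a tree that misses some finite string. Let `k` bound the lengths of these missed
strings, and let `D` be the remaining sample values. By hypothesis some stationary ergodic `P` gives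
`D` arbitrarily small probability. If `Q` has all strings of length at most `k` among the nodes of
its context tree, then its tree can lie below `U` only on `D`. So it is enough to find such a `Q`
with finite context tree and `Q(D)` at most `P(D) + ε`; this is `exists_statErgodicFinite_approx`.

To construct `Q`, average over a path of `P` to get a sequence `w` of period `L` that visits `D`
with frequency at most `P(D) + n / L` (`exists_periodic_count_le`). Run a chain with memory `M + 1`
whose rule `steer w` forces the past onto `w` within `M` steps (`exists_eq_of_follow`), and disobey
the rule with small probability. Disobedience has two uses. Writing arbitrary letters makes every
string possible and makes the chain forget its initial state, so that it is a factor of an i.i.d.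
process and hence ergodic. Copying the oldest remembered symbol makes the contexts exactly the
strings of length `M + 1` (`contextTree_chainLaw`). While the rule is obeyed, block frequencies are
those of `w` (`chainLaw_steer_block_le`). -/

namespace CT

/-! ### Ergodicity of i.i.d. processes -/

section Shift

variable {B : Type*}

lemma shift_iterate (n : ℕ) (ω : ℤ → B) : shift^[n] ω = fun i => ω (i + n) := by
  induction n generalizing ω with
  | zero => simp
  | succ n ih =>
    rw [Function.iterate_succ_apply, ih]
    funext i
    simp only [shift]
    congr 1
    push_cast
    ring

variable [MeasurableSpace B]

lemma measurable_shift : Measurable (shift : (ℤ → B) → ℤ → B) :=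
  measurable_pi_lambda _ fun i => measurable_pi_apply (i + 1)

lemma measurePreserving_shift_infinitePi (ν : Measure B) [IsProbabilityMeasure ν] :
    MeasurePreserving shift (Measure.infinitePi fun _ : ℤ => ν)
      (Measure.infinitePi fun _ : ℤ => ν) := by
  refine ⟨measurable_shift, Measure.eq_infinitePi _ fun s t ht => ?_⟩
  rw [Measure.map_apply measurable_shift (.pi s.countable_toSet fun i _ => ht i)]
  have h : shift ⁻¹' (Set.pi s t) =
      Set.pi (s.map (Equiv.addRight (1 : ℤ)).toEmbedding : Finset ℤ) fun i => t (i - 1) := by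
    ext ω
    simp only [shift, Set.mem_preimage, Set.mem_pi, Finset.mem_coe, Finset.mem_map_equiv,
      Equiv.addRight_symm_apply]
    exact ⟨fun h i hi => by simpa [← sub_eq_add_neg] using h _ hi, fun h i hi => by simpa using h (i + 1) (by simpa)⟩
  rw [h, Measure.infinitePi_pi _ fun i _ => ht _]
  simp

/-- Under a product measure, an event depending on finitely many coordinates is independent of
its remote translates. -/
lemma exists_measure_inter_preimage_shift (ν : Measure B) [IsProbabilityMeasure ν]
    {C : Set (ℤ → B)} (hC : C ∈ measurableCylinders fun _ : ℤ => B) :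
    ∃ n : ℕ, (Measure.infinitePi fun _ : ℤ => ν) (C ∩ shift^[n] ⁻¹' C) =
      (Measure.infinitePi fun _ : ℤ => ν) C * (Measure.infinitePi fun _ : ℤ => ν) C := by
  obtain ⟨I, S, hS, rfl⟩ := (mem_measurableCylinders _).1 hC
  obtain ⟨b, hb⟩ : ∃ b : ℕ, ∀ i ∈ I, i.natAbs ≤ b :=
    ⟨I.sup Int.natAbs, fun i hi => Finset.le_sup (f := Int.natAbs) hi⟩
  -- All coordinates lie in `[-b, b]`, an interval that a translation by `2 * b + 1` makes disjoint
  -- from itself.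
  set n : ℕ := 2 * b + 1
  refine ⟨n, ?_⟩
  set T : Finset ℤ := I.map (Equiv.addRight (n : ℤ)).toEmbedding with hT
  have hmem : ∀ i : I, (i : ℤ) + n ∈ T := fun i => by simp [hT]
  have hdisj : Disjoint I T := by
    rw [Finset.disjoint_left]
    intro i hi hi'
    obtain ⟨j, hj, rfl⟩ := Finset.mem_map.1 hi'
    have h1 := hb _ hi
    have h2 := hb _ hj
    simp only [Equiv.toEmbedding_apply, Equiv.coe_addRight] at h1
    omega
  have hind := (iIndepFun_infinitePi (P := fun _ : ℤ => ν) (X := fun _ b => b)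
    fun _ => measurable_id).indepFun_finset I T hdisj fun i => measurable_pi_apply i
  have hS' : MeasurableSet {y : T → B | (fun i : I => y ⟨i + n, hmem i⟩) ∈ S} :=
    (measurable_pi_lambda _ fun i => measurable_pi_apply _) hS
  have key := hind.measure_inter_preimage_eq_mul _ _ hS hS'
  have h2 : shift^[n] ⁻¹' cylinder I S = (fun (ω : ℤ → B) (i : T) => ω i) ⁻¹'
      {y : T → B | (fun i : I => y ⟨i + n, hmem i⟩) ∈ S} := by
    ext ω
    simp [cylinder, shift_iterate, Finset.restrict_def]
  rw [← h2] at key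
  have h3 := ((measurePreserving_shift_infinitePi ν).iterate n).measure_preimage
    (MeasurableSet.cylinder I hS).nullMeasurableSet
  rw [h3] at key
  exact key

/-- An invariant event is nearly a cylinder `C`, hence also nearly `C` intersected with a remote
translate of `C`, whose measure is the square of that of `C`. So the measure of the event equals its
own square. -/
theorem ergodic_shift_infinitePi (ν : Measure B) [IsProbabilityMeasure ν] :
    Ergodic shift (Measure.infinitePi fun _ : ℤ => ν) := by
  set μ := Measure.infinitePi fun _ : ℤ => ν
  have hmp := measurePreserving_shift_infinitePi ν
  refine ⟨hmp, ⟨fun E hE hinv => ?_⟩⟩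
  have hsq : μ.real E = μ.real E * μ.real E := by
    refine eq_of_abs_sub_le_all fun ε hε => ?_
    obtain ⟨C, hC, hCE⟩ := exists_measure_symmDiff_lt_of_generateFrom_isSetRing (μ := μ)
      isSetRing_measurableCylinders
      ⟨{Set.univ}, by simp, by simpa using univ_mem_measurableCylinders fun _ : ℤ => B, by simp⟩
      generateFrom_measurableCylinders.symm hE (ε := ENNReal.ofReal (ε / 4))
      (by simpa using hε)
    have hCm : MeasurableSet C := by
      obtain ⟨I, S, hS, rfl⟩ := (mem_measurableCylinders _).1 hC
      exact .cylinder I hS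
    obtain ⟨n, hn⟩ := exists_measure_inter_preimage_shift ν hC
    have hn' : μ.real (C ∩ shift^[n] ⁻¹' C) = μ.real C * μ.real C := by
      simp only [Measure.real]
      rw [← ENNReal.toReal_mul]
      exact congrArg _ hn
    have hmpn := hmp.iterate n
    have hinvn : shift^[n] ⁻¹' E = E := by
      rw [Set.preimage_iterate_eq]
      exact Function.iterate_fixed hinv n
    have hCE' : μ.real (symmDiff C E) ≤ ε / 4 := by
      refine ENNReal.toReal_le_of_le_ofReal (by positivity) hCE.le
    have hCE2 : μ.real (shift^[n] ⁻¹' symmDiff C E) ≤ ε / 4 := by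
      rw [measureReal_def, hmpn.measure_preimage (hCm.symmDiff hE).nullMeasurableSet]
      exact hCE'
    have h1 : |μ.real C - μ.real E| ≤ ε / 4 :=
      (abs_measureReal_sub_le_measureReal_symmDiff hCm.nullMeasurableSet
        hE.nullMeasurableSet).trans hCE'
    have h2 : |μ.real (C ∩ shift^[n] ⁻¹' C) - μ.real E| ≤ ε / 2 := by
      refine (abs_measureReal_sub_le_measureReal_symmDiff
        (hCm.inter (hmpn.measurable hCm)).nullMeasurableSet hE.nullMeasurableSet).trans ?_
      have hsub : symmDiff (C ∩ shift^[n] ⁻¹' C) E ⊆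
          symmDiff C E ∪ shift^[n] ⁻¹' symmDiff C E := by
        intro ω hω
        have hE' : shift^[n] ω ∈ E ↔ ω ∈ E := by
          rw [← Set.mem_preimage, hinvn]
        simp only [Set.mem_union, Set.mem_preimage, Set.mem_symmDiff, Set.mem_inter_iff] at hω ⊢
        tauto
      refine (measureReal_mono hsub).trans ((measureReal_union_le _ _).trans ?_)
      linarith
    rw [hn'] at h2
    have hc1 : μ.real C ≤ 1 := measureReal_le_one
    have he1 : μ.real E ≤ 1 := measureReal_le_one
    have hc0 : 0 ≤ μ.real C := measureReal_nonneg
    have he0 : 0 ≤ μ.real E := measureReal_nonneg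
    rw [abs_le] at h1 h2 ⊢
    constructor <;> nlinarith
  have h01 : μ.real E = 0 ∨ μ.real E = 1 := by
    by_cases h : μ.real E = 0
    · exact Or.inl h
    · exact Or.inr (mul_left_cancel₀ h (by linarith))
  rw [Filter.eventuallyConst_set']
  rcases h01 with h | h
  · left
    rw [ae_eq_empty]
    exact (measureReal_eq_zero_iff).1 h
  · right
    rw [ae_eq_univ, prob_compl_eq_zero_iff hE]
    have := ENNReal.toReal_eq_one_iff (μ E)
    exact this.1 h

end Shift

/-! ### Coupling from the past for a finite automaton driven by i.i.d. input -/

section Coupling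

variable {S B : Type*}

/-- The state at time `t` of the automaton `G` driven by `ω`, started from `s` at time `t - N`. -/
def run (G : S → B → S) (ω : ℤ → B) : ℤ → ℕ → S → S
  | _, 0, s => s
  | t, N + 1, s => G (run G ω (t - 1) N s) (ω (t - 1))

variable (G : S → B → S)

lemma run_shift (ω : ℤ → B) (t : ℤ) (N : ℕ) (s : S) :
    run G (shift ω) t N s = run G ω (t + 1) N s := by
  induction N generalizing t with
  | zero => rfl
  | succ N ih =>
    simp only [run, ih, shift]
    rw [show t - 1 + 1 = t + 1 - 1 by ring]

lemma run_add (ω : ℤ → B) (t : ℤ) (N K : ℕ) (s : S) :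
    run G ω t (N + K) s = run G ω t N (run G ω (t - N) K s) := by
  induction N generalizing t with
  | zero => simp [run]
  | succ N ih =>
    rw [show N + 1 + K = (N + K) + 1 by ring]
    simp only [run, ih]
    rw [show t - 1 - (N : ℤ) = t - ((N + 1 : ℕ) : ℤ) by push_cast; ring]

/-- All runs that started `N` steps before time `t` have merged at time `t`. -/
def Coalesces (ω : ℤ → B) (t : ℤ) (N : ℕ) : Prop :=
  ∀ s s', run G ω t N s = run G ω t N s'

variable {G}

lemma Coalesces.succ {ω : ℤ → B} {t : ℤ} {N : ℕ} (h : Coalesces G ω t N) :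
    Coalesces G ω (t + 1) (N + 1) := fun s s' => by
  simp only [run, add_sub_cancel_right]
  rw [h s s']

lemma coalesces_shift {ω : ℤ → B} {t : ℤ} {N : ℕ} :
    Coalesces G (shift ω) t N ↔ Coalesces G ω (t + 1) N := by
  simp only [Coalesces, run_shift]

lemma Coalesces.of_le {ω : ℤ → B} {t u : ℤ} {N : ℕ} (h : Coalesces G ω t N) (htu : t ≤ u) :
    ∃ K, Coalesces G ω u K := by
  obtain ⟨k, rfl⟩ := Int.le.dest htu
  refine ⟨N + k, ?_⟩
  induction k with
  | zero => simpa using h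
  | succ k ih =>
    have := (ih (by simp)).succ
    rwa [show t + (k : ℤ) + 1 = t + ((k + 1 : ℕ) : ℤ) by push_cast; ring] at this

variable (G) in
/-- The common state at time `t` of all runs from the remote past. -/
noncomputable def stateAt [Nonempty S] (ω : ℤ → B) (t : ℤ) : S :=
  -- If the runs never merge, the infimum is `0` and the value is the arbitrary state.
  run G ω t (sInf {N | Coalesces G ω t N}) (Classical.arbitrary S)

variable [Nonempty S]

lemma stateAt_shift (ω : ℤ → B) (t : ℤ) : stateAt G (shift ω) t = stateAt G ω (t + 1) := by
  simp only [stateAt, coalesces_shift, run_shift]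

lemma Coalesces.run_eq {ω : ℤ → B} {t : ℤ} {N : ℕ} (h : Coalesces G ω t N) (s : S) :
    run G ω t N s = stateAt G ω t := by
  have hne : {N | Coalesces G ω t N}.Nonempty := ⟨N, h⟩
  have hmem := Nat.sInf_mem hne
  obtain ⟨k, hk⟩ := Nat.exists_eq_add_of_le (Nat.sInf_le (show N ∈ {N | Coalesces G ω t N} from h))
  rw [hk, run_add, stateAt]
  exact hmem _ _

lemma Coalesces.stateAt_succ {ω : ℤ → B} {t : ℤ} {N : ℕ} (h : Coalesces G ω t N) :
    stateAt G ω (t + 1) = G (stateAt G ω t) (ω t) := by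
  rw [← h.succ.run_eq (Classical.arbitrary S)]
  simp only [run, add_sub_cancel_right]
  rw [h.run_eq]

variable [MeasurableSpace S] [DiscreteMeasurableSpace S] [Finite S]
  [MeasurableSpace B] [DiscreteMeasurableSpace B] [Finite B]

variable (B) in
/-- The σ-algebra generated by the coordinates before time `t`. -/
@[reducible]
def pastSigma (t : ℤ) : MeasurableSpace (ℤ → B) :=
  ⨆ i ∈ Set.Iio t, MeasurableSpace.comap (fun ω => ω i) inferInstance

omit [DiscreteMeasurableSpace B] [Finite B] in
lemma pastSigma_le (t : ℤ) : pastSigma B t ≤ MeasurableSpace.pi :=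
  iSup₂_le fun i _ => (measurable_pi_apply i).comap_le

omit [DiscreteMeasurableSpace B] [Finite B] in
lemma pastSigma_mono {t u : ℤ} (h : t ≤ u) : pastSigma B t ≤ pastSigma B u :=
  biSup_mono fun _ hi => lt_of_lt_of_le hi h

omit [DiscreteMeasurableSpace B] [Finite B] in
lemma measurable_pastSigma_apply {t i : ℤ} (h : i < t) :
    Measurable[pastSigma B t] (fun ω : ℤ → B => ω i) := by
  rw [measurable_iff_comap_le]
  exact le_iSup₂_of_le i h le_rfl

omit [Nonempty S] in
lemma measurable_run (G : S → B → S) (t : ℤ) (N : ℕ) (s : S) :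
    Measurable[pastSigma B t] (fun ω : ℤ → B => run G ω t N s) := by
  induction N generalizing t with
  | zero => exact measurable_const
  | succ N ih =>
    have h1 := (ih (t - 1)).mono (pastSigma_mono (by simp : t - 1 ≤ t)) le_rfl
    have h2 := measurable_pastSigma_apply (B := B) (show t - 1 < t by simp)
    exact (measurable_of_countable (fun p : S × B => G p.1 p.2)).comp (h1.prodMk h2)

omit [Nonempty S] in
lemma measurableSet_coalesces (G : S → B → S) (t : ℤ) (N : ℕ) :
    MeasurableSet[pastSigma B t] {ω : ℤ → B | Coalesces G ω t N} := by
  simp only [Coalesces, Set.ofPred_forall]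
  refine MeasurableSet.iInter fun s => MeasurableSet.iInter fun s' => ?_
  exact measurableSet_eq_fun (m := pastSigma B t) (measurable_run G t N s)
    (measurable_run G t N s')

/-- Every merging time gives the same state, so the preimage is a countable union over all merging
times `N`, together with the event that no merging occurs. -/
lemma measurable_stateAt (G : S → B → S) (t : ℤ) :
    Measurable[pastSigma B t] (fun ω : ℤ → B => stateAt G ω t) := by
  intro T _
  have h : (fun ω : ℤ → B => stateAt G ω t) ⁻¹' T =
      (⋃ N, {ω | Coalesces G ω t N} ∩ (fun ω => run G ω t N (Classical.arbitrary S)) ⁻¹' T) ∪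
      ((⋃ N, {ω | Coalesces G ω t N})ᶜ ∩
        (fun ω => run G ω t 0 (Classical.arbitrary S)) ⁻¹' T) := by
    ext ω
    simp only [Set.mem_preimage, Set.mem_union, Set.mem_iUnion, Set.mem_inter_iff,
      Set.mem_compl_iff, Set.mem_ofPred_eq]
    by_cases hc : ∃ N, Coalesces G ω t N
    · obtain ⟨N, hN⟩ := hc
      constructor
      · intro h
        exact Or.inl ⟨N, hN, by rwa [hN.run_eq]⟩
      · rintro (⟨K, hK, h⟩ | ⟨h, -⟩)
        · rwa [hK.run_eq] at h
        · exact absurd ⟨N, hN⟩ h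
    · have he : {N | Coalesces G ω t N} = ∅ := by
        ext N
        simpa using fun hN => hc ⟨N, hN⟩
      have hs : stateAt G ω t = run G ω t 0 (Classical.arbitrary S) := by
        rw [stateAt, he, Nat.sInf_empty]
      rw [hs]
      constructor
      · exact fun h => Or.inr ⟨hc, h⟩
      · rintro (⟨K, hK, h⟩ | ⟨-, h⟩)
        · exact absurd ⟨K, hK⟩ hc
        · exact h
  rw [h]
  have hT : MeasurableSet T := .of_discrete
  refine MeasurableSet.union (MeasurableSet.iUnion fun N => ?_) (MeasurableSet.inter ?_ ?_)
  · exact (measurableSet_coalesces G t N).inter (measurable_run G t N _ hT)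
  · exact (MeasurableSet.iUnion fun N => measurableSet_coalesces G t N).compl
  · exact measurable_run G t 0 _ hT

omit [Nonempty S] in
/-- If merging has positive probability, then it happens almost surely, at all times. -/
theorem ae_forall_coalesces (G : S → B → S) (ν : Measure B) [IsProbabilityMeasure ν] (K : ℕ)
    (h : 0 < (Measure.infinitePi fun _ : ℤ => ν) {ω | Coalesces G ω 0 K}) :
    ∀ᵐ ω ∂(Measure.infinitePi fun _ : ℤ => ν), ∀ t, ∃ N, Coalesces G ω t N := by
  set μ := Measure.infinitePi fun _ : ℤ => ν
  have hmeas : ∀ t, MeasurableSet {ω : ℤ → B | ∃ N, Coalesces G ω t N} := fun t => by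
    simp only [Set.ofPred_exists]
    exact MeasurableSet.iUnion fun N => pastSigma_le t _ (measurableSet_coalesces G t N)
  have h0 : ∀ᵐ ω ∂μ, ∃ N, Coalesces G ω 0 N := by
    -- Runs that have merged stay merged, so the event is contained in its shift preimage. By
    -- ergodicity it is null or full.
    have hsub : {ω : ℤ → B | ∃ N, Coalesces G ω 0 N} ⊆
        shift ⁻¹' {ω : ℤ → B | ∃ N, Coalesces G ω 0 N} := by
      rintro ω ⟨N, hN⟩
      exact ⟨N + 1, coalesces_shift.2 hN.succ⟩
    rcases (ergodic_shift_infinitePi ν).ae_empty_or_univ_of_ae_le_preimage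
      (hmeas 0).nullMeasurableSet hsub.eventuallyLE with h' | h'
    · rw [ae_eq_empty] at h'
      exact absurd (measure_mono_null
        (show {ω | Coalesces G ω 0 K} ⊆ {ω | ∃ N, Coalesces G ω 0 N} from fun ω hω => ⟨K, hω⟩) h')
        h.ne'
    · rwa [Filter.eventuallyEq_univ] at h'
  -- Stationarity carries merging to all times `-k`; `Coalesces.of_le` then propagates it forward to
  -- every time.
  have hneg : ∀ k : ℕ, ∀ᵐ ω ∂μ, ∃ N, Coalesces G ω (-k) N := fun k => by
    have hmp := (measurePreserving_shift_infinitePi ν).iterate k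
    suffices h : ∀ᵐ ω ∂(μ.map shift^[k]), ∃ N, Coalesces G ω (-k) N by rwa [hmp.map_eq] at h
    rw [ae_map_iff hmp.measurable.aemeasurable (hmeas _)]
    filter_upwards [h0] with ω hω
    have key : ∀ (k : ℕ) (t : ℤ) (N : ℕ), Coalesces G (shift^[k] ω) t N ↔
        Coalesces G ω (t + k) N := by
      intro k
      induction k with
      | zero => simp
      | succ k ih =>
        intro t N
        rw [Function.iterate_succ_apply', coalesces_shift, ih]
        push_cast
        rw [show t + 1 + (k : ℤ) = t + (k + 1) by ring]
    simpa [key] using hω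
  filter_upwards [ae_all_iff.2 hneg] with ω hω t
  obtain ⟨N, hN⟩ := hω t.natAbs
  exact hN.of_le (by omega)

omit [Finite B] in
/-- Functions of the past are independent of the present. -/
lemma measure_inter_pastSigma (ν : Measure B) [IsProbabilityMeasure ν] (t : ℤ)
    {E : Set (ℤ → B)} (hE : MeasurableSet[pastSigma B t] E) (T : Set B) :
    (Measure.infinitePi fun _ : ℤ => ν) (E ∩ {ω | ω t ∈ T}) =
      (Measure.infinitePi fun _ : ℤ => ν) E * ν T := by
  have hind := indep_iSup_of_disjoint (fun i => (measurable_pi_apply i).comap_le)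
    (iIndepFun_infinitePi (P := fun _ : ℤ => ν) (X := fun _ b => b) fun _ => measurable_id)
    (S := Set.Iio t) (T := {t}) (by simp)
  have hT : MeasurableSet T := .of_discrete
  have h2 : MeasurableSet[⨆ i ∈ ({t} : Set ℤ), MeasurableSpace.comap (fun ω : ℤ → B => ω i)
      inferInstance] {ω : ℤ → B | ω t ∈ T} :=
    (le_iSup₂_of_le (f := fun i (_ : i ∈ ({t} : Set ℤ)) => MeasurableSpace.comap
      (fun ω : ℤ → B => ω i) inferInstance) t rfl le_rfl) _ ⟨T, hT, rfl⟩
  rw [(Indep_iff _ _ _).1 hind E _ hE h2]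
  congr 1
  exact (measurePreserving_eval_infinitePi (fun _ : ℤ => ν) t).measure_preimage
    hT.nullMeasurableSet

omit [Finite B] in
lemma measure_forall_mem_eq_pos (ν : Measure B) [IsProbabilityMeasure ν]
    (hν : ∀ b, 0 < ν {b}) (I : Finset ℤ) (x : ℤ → B) :
    0 < (Measure.infinitePi fun _ : ℤ => ν) {ω | ∀ i ∈ I, ω i = x i} := by
  have h : {ω : ℤ → B | ∀ i ∈ I, ω i = x i} = Set.pi I fun i => {x i} := by
    ext ω
    simp [Set.mem_pi]
  rw [h, Measure.infinitePi_pi _ fun i _ => .of_discrete]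
  exact pos_iff_ne_zero.2 (Finset.prod_ne_zero_iff.2 fun i _ => (hν _).ne')

end Coupling

/-! ### The chain with memory `M + 1` and its context tree -/

/-- The possible instructions for producing the next symbol: follow the given rule, copy the
oldest remembered symbol, or write a prescribed letter. -/
inductive Innovation (A : Type*) where
  | follow : Innovation A
  | copy : Innovation A
  | letter (a : A) : Innovation A

instance (A : Type*) : MeasurableSpace (Innovation A) := ⊤

instance (A : Type*) : DiscreteMeasurableSpace (Innovation A) := ⟨fun _ => trivial⟩

instance (A : Type*) [Finite A] : Finite (Innovation A) :=
  Finite.of_surjective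
    (fun o : Option (Option A) => match o with
      | none => .follow
      | some none => .copy
      | some (some a) => .letter a)
    fun b => match b with
      | .follow => ⟨none, rfl⟩
      | .copy => ⟨some none, rfl⟩
      | .letter a => ⟨some (some a), rfl⟩

instance (A : Type*) : Nonempty (Innovation A) := ⟨.follow⟩

section Chain

variable {A : Type*} {M : ℕ}

/-- The symbol produced by an instruction when the past is `s`, most recent symbol first. -/
def nextSymbol (f : (Fin M → A) → A) (s : Fin (M + 1) → A) : Innovation A → A
  | .follow => f fun i => s i.castSucc
  | .copy => s (Fin.last M)
  | .letter a => a

def step (f : (Fin M → A) → A) (s : Fin (M + 1) → A) (b : Innovation A) : Fin (M + 1) → A :=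
  Fin.cons (nextSymbol f s b) fun i => s i.castSucc

lemma run_step_apply_of_letter (f : (Fin M → A) → A) {ω : ℤ → Innovation A} {a : A} (N : ℕ)
    (t : ℤ) (s : Fin (M + 1) → A) (i : Fin (M + 1)) (hi : (i : ℕ) < N)
    (h : ω (t - 1 - (i : ℕ)) = .letter a) : run (step f) ω t N s i = a := by
  induction N generalizing t i with
  | zero => simp at hi
  | succ N ih =>
    rw [run, step]
    cases i using Fin.cases with
    | zero =>
      rw [Fin.cons_zero]
      simp only [Fin.coe_ofNat_eq_mod, Nat.zero_mod, Nat.cast_zero, sub_zero] at h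
      rw [h, nextSymbol]
    | succ i =>
      rw [Fin.cons_succ]
      refine ih (t - 1) i.castSucc (by simpa using hi) ?_
      rw [← h]
      congr 1
      simp only [Fin.val_castSucc, Fin.val_succ]
      push_cast
      ring

/-- Prescribing `M + 1` letters in a row overwrites the whole memory. -/
lemma coalesces_step_of_letter (f : (Fin M → A) → A) {ω : ℤ → Innovation A} (a : A)
    (h : ∀ i ∈ Finset.Ico (-((M : ℤ) + 1)) 0, ω i = .letter a) :
    Coalesces (step f) ω 0 (M + 1) := fun s s' => by
  have key : ∀ s : Fin (M + 1) → A, run (step f) ω 0 (M + 1) s = fun _ => a := fun s => by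
    funext i
    have hi := i.2
    exact run_step_apply_of_letter f _ 0 s i i.2 (h _ (by simp; omega))
  rw [key, key]

variable [Nonempty A]

/-- The stationary process in which the instructions `ω` are carried out at all times. -/
noncomputable def process (f : (Fin M → A) → A) (ω : ℤ → Innovation A) (t : ℤ) : A :=
  -- The state at time `t` holds the symbols strictly before `t`, so the symbol at `t` is the newest
  -- entry at time `t + 1`.
  stateAt (step f) ω (t + 1) 0

lemma process_shift (f : (Fin M → A) → A) (ω : ℤ → Innovation A) :
    process f (shift ω) = shift (process f ω) := by
  funext t
  simp only [process, stateAt_shift, shift]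

lemma process_eq {f : (Fin M → A) → A} {ω : ℤ → Innovation A}
    (h : ∀ t, ∃ N, Coalesces (step f) ω t N) (t : ℤ) :
    process f ω t = nextSymbol f (stateAt (step f) ω t) (ω t) := by
  obtain ⟨N, hN⟩ := h t
  rw [process, hN.stateAt_succ, step, Fin.cons_zero]

lemma stateAt_apply {f : (Fin M → A) → A} {ω : ℤ → Innovation A}
    (h : ∀ t, ∃ N, Coalesces (step f) ω t N) (t : ℤ) (i : Fin (M + 1)) :
    stateAt (step f) ω t i = process f ω (t - 1 - (i : ℕ)) := by
  induction i using Fin.induction generalizing t with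
  | zero => simp [process]
  | succ i ih =>
    obtain ⟨N, hN⟩ := h (t - 1)
    have h1 := hN.stateAt_succ
    rw [sub_add_cancel] at h1
    rw [h1, step, Fin.cons_succ, ih]
    congr 1
    simp only [Fin.val_castSucc, Fin.val_succ]
    push_cast
    ring

variable [Finite A] [MeasurableSpace A] [DiscreteMeasurableSpace A]

lemma measurable_process_apply (f : (Fin M → A) → A) (t : ℤ) :
    Measurable[pastSigma (Innovation A) (t + 1)]
      (fun ω : ℤ → Innovation A => process f ω t) :=
  (measurable_pi_apply 0).comp (measurable_stateAt (step f) (t + 1))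

lemma measurable_process (f : (Fin M → A) → A) : Measurable (process f) :=
  measurable_pi_lambda _ fun t => (measurable_process_apply f t).mono (pastSigma_le _) le_rfl

/-- The law of `process f` when the instructions are i.i.d. with law `ν`. -/
noncomputable def chainLaw (f : (Fin M → A) → A) (ν : Measure (Innovation A))
    [IsProbabilityMeasure ν] : Measure (ℤ → A) :=
  (Measure.infinitePi fun _ : ℤ => ν).map (process f)

variable (f : (Fin M → A) → A) (ν : Measure (Innovation A)) [IsProbabilityMeasure ν]

lemma chainLaw_apply {E : Set (ℤ → A)} (hE : MeasurableSet E) :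
    chainLaw f ν E = (Measure.infinitePi fun _ : ℤ => ν) (process f ⁻¹' E) :=
  Measure.map_apply (measurable_process f) hE

instance : IsProbabilityMeasure (chainLaw f ν) :=
  Measure.isProbabilityMeasure_map (measurable_process f).aemeasurable

theorem chainLaw_mem_statErgodic : chainLaw f ν ∈ statErgodic A := by
  refine ⟨inferInstance, ?_⟩
  have hmp : MeasurePreserving (process f) (Measure.infinitePi fun _ : ℤ => ν) (chainLaw f ν) :=
    ⟨measurable_process f, rfl⟩
  exact hmp.ergodic_of_ergodic_semiconj (ergodic_shift_infinitePi ν) measurable_shift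
    fun ω => process_shift f ω

omit [Nonempty A] [Finite A] in
lemma measurableSet_pastEvent (v : List A) : MeasurableSet (pastEvent v) := by
  simp only [pastEvent, Set.ofPred_forall]
  exact MeasurableSet.iInter fun i => measurable_pi_apply (X := fun _ : ℤ => A) _
    (measurableSet_singleton _)

lemma measurableSet_process_pastEvent (v : List A) :
    MeasurableSet[pastSigma (Innovation A) 0] (process f ⁻¹' pastEvent v) := by
  have h : process f ⁻¹' pastEvent v = ⋂ i : Fin v.length,
      {ω | process f ω ((i : ℤ) - v.length) = v.get i} := by
    ext ω
    simp [pastEvent]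
  rw [h]
  refine MeasurableSet.iInter fun i => ?_
  have hi := i.2
  have := (measurable_process_apply f ((i : ℤ) - v.length)).mono
    (pastSigma_mono (show ((i : ℤ) - v.length) + 1 ≤ 0 by omega)) le_rfl
  exact this (measurableSet_singleton _)

/-- The last `M + 1` symbols of a string, most recent first. -/
def recent (v : List A) (h : M + 1 ≤ v.length) : Fin (M + 1) → A :=
  fun i => v[v.length - 1 - i]'(by omega)

omit [Nonempty A] [Finite A] [MeasurableSpace A] [DiscreteMeasurableSpace A] in
lemma recent_of_suffix {s v : List A} (hsv : s <:+ v) (hs : M + 1 ≤ s.length) :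
    recent v (hs.trans hsv.length_le) = recent s hs := by
  obtain ⟨t, rfl⟩ := hsv
  funext i
  have hi := i.2
  simp only [recent]
  rw [List.getElem_append_right (by simp; omega)]
  congr 1
  simp
  omega

variable {ν} (hν : ∀ b, 0 < ν {b})

include hν

lemma ae_process_coalesces :
    ∀ᵐ ω ∂(Measure.infinitePi fun _ : ℤ => ν), ∀ t, ∃ N, Coalesces (step f) ω t N := by
  obtain ⟨a⟩ := ‹Nonempty A›
  refine ae_forall_coalesces (step f) ν (M + 1) ?_
  refine (measure_forall_mem_eq_pos ν hν (Finset.Ico (-((M : ℤ) + 1)) 0)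
    (fun _ => .letter a)).trans_le (measure_mono fun ω hω => ?_)
  exact coalesces_step_of_letter f a hω

/-- The instructions may simply spell out `v`. -/
lemma chainLaw_pastEvent_pos (v : List A) : 0 < chainLaw f ν (pastEvent v) := by
  obtain ⟨a⟩ := ‹Nonempty A›
  rw [chainLaw_apply f ν (measurableSet_pastEvent v)]
  refine (measure_forall_mem_eq_pos ν hν (Finset.Ico (-(v.length : ℤ)) 0)
    (fun i => .letter (v.getD (i + v.length).toNat a))).trans_le (measure_mono_ae ?_)
  filter_upwards [ae_process_coalesces f hν] with ω hc hω
  intro i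
  have hi := i.2
  have h1 := hω ((i : ℤ) - v.length) (by simp)
  rw [process_eq hc, h1, nextSymbol]
  simp

/-- Such a `v` fixes the state at time `0`, while the instruction at time `0` is independent of the
past. -/
lemma chainLaw_inter (v : List A) (h : M + 1 ≤ v.length) (a : A) :
    chainLaw f ν (pastEvent v ∩ {ω | ω 0 = a}) =
      chainLaw f ν (pastEvent v) * ν {b | nextSymbol f (recent v h) b = a} := by
  have h0 : MeasurableSet {ω : ℤ → A | ω 0 = a} :=
    measurable_pi_apply (X := fun _ : ℤ => A) 0 (measurableSet_singleton a)
  rw [chainLaw_apply f ν (measurableSet_pastEvent v),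
    chainLaw_apply f ν ((measurableSet_pastEvent v).inter h0),
    ← measure_inter_pastSigma ν 0 (measurableSet_process_pastEvent f v)]
  refine measure_congr ?_
  filter_upwards [ae_process_coalesces f hν] with ω hc
  refine propext (and_congr_right fun hω => ?_)
  have hst : stateAt (step f) ω 0 = recent v h := by
    funext i
    have hi := i.2
    rw [stateAt_apply hc, recent]
    have := hω ⟨v.length - 1 - i, by omega⟩
    rw [List.get_eq_getElem] at this
    rw [← this]
    congr 1
    push_cast
    omega
  change process f ω 0 = a ↔ nextSymbol f (recent v h) (ω 0) = a
  rw [process_eq hc, hst]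

lemma transProb_chainLaw (v : List A) (h : M + 1 ≤ v.length) (a : A) :
    transProb (chainLaw f ν) v a = ν {b | nextSymbol f (recent v h) b = a} := by
  rw [transProb, cond_apply (measurableSet_pastEvent v), chainLaw_inter f hν v h, ← mul_assoc,
    ENNReal.inv_mul_cancel (chainLaw_pastEvent_pos f hν v).ne' (measure_ne_top _ _), one_mul]

lemma determinesNext_of_le_length (s : List A) (h : M + 1 ≤ s.length) :
    DeterminesNext (chainLaw f ν) s := fun a v hsv _ => by
  rw [transProb_chainLaw f hν s h, transProb_chainLaw f hν v (h.trans hsv.length_le),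
    recent_of_suffix hsv h]

-- The rule and the prescribed letters do not see the oldest symbol; only `copy` does, and it has
-- positive mass. Hence the chain depends on the oldest symbol whatever the rule `f` is.
omit [Nonempty A] [Finite A] [MeasurableSpace A] [DiscreteMeasurableSpace A]
  [IsProbabilityMeasure ν] in
lemma measure_nextSymbol_lt [IsFiniteMeasure ν] {s s' : Fin (M + 1) → A}
    (h : ∀ i : Fin M, s i.castSucc = s' i.castSucc) (hne : s (Fin.last M) ≠ s' (Fin.last M)) :
    ν {b | nextSymbol f s' b = s (Fin.last M)} < ν {b | nextSymbol f s b = s (Fin.last M)} := by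
  have hd : Disjoint {b | nextSymbol f s' b = s (Fin.last M)} {Innovation.copy} := by
    rw [Set.disjoint_singleton_right]
    exact fun hb => hne hb.symm
  have hsub : {b | nextSymbol f s' b = s (Fin.last M)} ∪ {Innovation.copy} ⊆
      {b | nextSymbol f s b = s (Fin.last M)} := by
    rintro b (hb | rfl)
    · cases b with
      | follow =>
        change f _ = _ at hb ⊢
        rw [← hb]
        simp only [h]
      | copy => rfl
      | letter a => exact hb
    · rfl
  refine lt_of_lt_of_le ?_ (measure_mono hsub)
  rw [measure_union hd .of_discrete]
  exact ENNReal.lt_add_right (measure_ne_top _ _) (hν _).ne'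

lemma not_determinesNext_of_length_le [Nontrivial A] (s : List A) (h : s.length ≤ M) :
    ¬ DeterminesNext (chainLaw f ν) s := by
  intro hs
  obtain ⟨b, c, hbc⟩ := exists_pair_ne A
  -- Pad `s` to length `M` and prepend `b` or `c`: two extensions that differ only in the oldest
  -- remembered symbol.
  set u := List.replicate (M - s.length) b ++ s
  have hu : u.length = M := by simp [u, h]
  have hv : ∀ d : A, s <:+ d :: u := fun d =>
    (List.suffix_append _ s).trans (List.suffix_cons d u)
  have hl : ∀ d : A, M + 1 ≤ (d :: u).length := fun d => by simp [hu]
  have hlast : ∀ d : A, recent (d :: u) (hl d) (Fin.last M) = d := fun d => by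
    simp [recent, hu]
  have key := (hs b _ (hv b) (chainLaw_pastEvent_pos f hν _)).trans
    (hs b _ (hv c) (chainLaw_pastEvent_pos f hν _)).symm
  rw [transProb_chainLaw f hν _ (hl b), transProb_chainLaw f hν _ (hl c)] at key
  have hlt := measure_nextSymbol_lt f hν (s := recent (b :: u) (hl b))
    (s' := recent (c :: u) (hl c)) (fun i => ?_) (by rwa [hlast, hlast])
  · rw [hlast, key] at hlt
    exact lt_irrefl _ hlt
  · have hi := i.2
    have e : (b :: u).length - 1 - (i.castSucc : ℕ) = (M - 1 - i) + 1 := by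
      simp [hu]
      omega
    simp only [recent]
    simp only [List.length_cons, hu, Fin.val_castSucc] at e ⊢
    simp only [e, List.getElem_cons_succ]

lemma isContext_chainLaw_iff [Nontrivial A] (s : List A) :
    IsContext (chainLaw f ν) s ↔ s.length = M + 1 := by
  constructor
  · rintro ⟨-, hs, hmin⟩
    refine le_antisymm ?_ (not_lt.1 fun h => not_determinesNext_of_length_le f hν s (by omega) hs)
    by_contra! hlt
    refine hmin (s.drop 1) (List.drop_suffix 1 s) (fun h => ?_)
      (determinesNext_of_le_length f hν _ (by simp; omega))
    have := congrArg List.length h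
    simp at this
    omega
  · intro hs
    refine ⟨Or.inl (chainLaw_pastEvent_pos f hν s), determinesNext_of_le_length f hν s hs.ge,
      fun u hu hne => not_determinesNext_of_length_le f hν u ?_⟩
    have h1 := hu.length_le
    have h2 : u.length ≠ s.length := fun h => hne (hu.eq_of_length h)
    omega

lemma contextTree_chainLaw [Nontrivial A] :
    contextTree (chainLaw f ν) = Leaf.str '' {s | s.length = M + 1} := by
  ext l
  constructor
  · rintro (⟨s, rfl, hs⟩ | ⟨x, rfl, hx⟩)
    · exact ⟨s, (isContext_chainLaw_iff f hν s).1 hs, rfl⟩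
    · exact absurd ((isContext_chainLaw_iff f hν _).2 (by simp [lastSymbols])) (hx (M + 1)).2
  · rintro ⟨s, hs, rfl⟩
    exact Or.inl ⟨s, rfl, (isContext_chainLaw_iff f hν s).2 hs⟩

theorem chainLaw_mem_statErgodicFinite [Nontrivial A] : chainLaw f ν ∈ statErgodicFinite A := by
  refine ⟨chainLaw_mem_statErgodic f ν, ?_⟩
  rw [contextTree_chainLaw f hν]
  exact (List.finite_length_eq A (M + 1)).image _

lemma mem_nodes_contextTree_chainLaw [Nontrivial A] (u : List A) (hu : u.length ≤ M + 1) :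
    u ∈ nodes (contextTree (chainLaw f ν)) := by
  obtain ⟨a⟩ := ‹Nonempty A›
  rw [contextTree_chainLaw f hν]
  exact ⟨_, ⟨List.replicate (M + 1 - u.length) a ++ u, by simp [hu], rfl⟩,
    List.suffix_append _ _⟩

end Chain

/-! ### A finite-memory rule that locks onto a periodic sequence -/

section Steering

variable {A : Type*} {M : ℕ}

/-- The recent past `s` (most recent symbol first) agrees with the end of `w 0, …, w (j - 1)`. -/
def Matches (w : ℕ → A) (j : ℕ) (s : Fin M → A) : Prop :=
  ∀ i : Fin M, (i : ℕ) < j → s i = w (j - 1 - i)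

open Classical in
/-- A rule that prolongs the longest agreement of the past with the sequence `w`. -/
noncomputable def steer (w : ℕ → A) (s : Fin M → A) : A :=
  if h : ∃ j, M ≤ j ∧ Matches w j s then w h.choose
  else w (Nat.findGreatest (fun j => Matches w j s) M)

variable (M) in
/-- The last `M` symbols before time `t`, most recent first. -/
def window (x : ℤ → A) (t : ℤ) : Fin M → A := fun i => x (t - 1 - (i : ℕ))

lemma Matches.succ {w : ℕ → A} {j : ℕ} {x : ℤ → A} {t : ℤ} (h : Matches w j (window M x t))
    (hx : x t = w j) : Matches w (j + 1) (window M x (t + 1)) := by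
  rintro ⟨i, hi⟩ hij
  simp only [window] at hij ⊢
  cases i with
  | zero => simpa using hx
  | succ i =>
    have := h ⟨i, by omega⟩ (by simpa using hij)
    simp only [window] at this
    rw [show t + 1 - 1 - ((i + 1 : ℕ) : ℤ) = t - 1 - (i : ℕ) by push_cast; ring, this]
    congr 1
    omega

/-- The index chosen in `steer` need not be `j`, but the continuation is the same: by periodicity it
is the symbol seen `L` steps ago, which `L ≤ M` keeps in the window. -/
lemma steer_eq {w : ℕ → A} {L : ℕ} (hL : 0 < L) (hLM : L ≤ M) (hw : ∀ j, w (j + L) = w j)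
    {s : Fin M → A} {j : ℕ} (hj : M ≤ j) (h : Matches w j s) : steer w s = w j := by
  have hex : ∃ j, M ≤ j ∧ Matches w j s := ⟨j, hj, h⟩
  rw [steer, dif_pos hex]
  have key : ∀ j, M ≤ j → Matches w j s → w j = s ⟨L - 1, by omega⟩ := by
    intro j hj h
    calc w j = w (j - 1 - (L - 1) + L) := by
          congr 1
          omega
      _ = w (j - 1 - (L - 1)) := hw _
      _ = s ⟨L - 1, by omega⟩ := (h ⟨L - 1, by omega⟩ (by simp; omega)).symm
  rw [key j hj h, key _ hex.choose_spec.1 hex.choose_spec.2]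

/-- Each obeyed step lengthens the agreement by at least one. The start is free, since agreement of
length `0` is vacuous; a rule choosing the longest agreement can only do better than the inductive
one. -/
lemma exists_matches_of_follow {w : ℕ → A} {L : ℕ} (hL : 0 < L) (hLM : L ≤ M)
    (hw : ∀ j, w (j + L) = w j) {x : ℤ → A} {t : ℤ} (k : ℕ) (hk : k ≤ M)
    (hx : ∀ i < k, x (t + (i : ℕ)) = steer w (window M x (t + (i : ℕ)))) :
    ∃ j, k ≤ j ∧ Matches w j (window M x (t + k)) := by
  induction k with
  | zero => exact ⟨0, le_rfl, fun i hi => absurd hi (Nat.not_lt_zero _)⟩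
  | succ k ih =>
    obtain ⟨j, hkj, hj⟩ := ih (by omega) fun i hi => hx i (by omega)
    have hstep := hx k (by omega)
    have hsucc : t + ((k + 1 : ℕ) : ℤ) = t + k + 1 := by push_cast; ring
    rw [hsucc]
    by_cases hfull : ∃ j, M ≤ j ∧ Matches w j (window M x (t + k))
    · obtain ⟨l, hl, hml⟩ := hfull
      exact ⟨l + 1, by omega, hml.succ (hstep.trans (steer_eq hL hLM hw hl hml))⟩
    · rw [steer, dif_neg hfull] at hstep
      classical
      set l := Nat.findGreatest (fun j => Matches w j (window M x (t + k))) M with hl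
      have hjM : j ≤ M := le_of_not_ge fun h => hfull ⟨j, h, hj⟩
      have hml : Matches w l (window M x (t + k)) :=
        Nat.findGreatest_spec (P := fun j => Matches w j (window M x (t + k))) hjM hj
      have hjl : j ≤ l := Nat.le_findGreatest hjM hj
      refine ⟨l + 1, by omega, hml.succ ?_⟩
      rw [hstep]

/-- A sequence obeying the rule `steer w` is, after `M` steps, a translate of `w`. -/
lemma exists_eq_of_follow {w : ℕ → A} {L : ℕ} (hL : 0 < L) (hLM : L ≤ M)
    (hw : ∀ j, w (j + L) = w j) {x : ℤ → A} {t : ℤ} (K : ℕ)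
    (hx : ∀ i < M + K, x (t + (i : ℕ)) = steer w (window M x (t + (i : ℕ)))) :
    ∃ j, ∀ k < K, x (t + M + (k : ℕ)) = w (j + k) := by
  obtain ⟨j, hj, hm⟩ := exists_matches_of_follow hL hLM hw M le_rfl fun i hi => hx i (by omega)
  refine ⟨j, ?_⟩
  have hstep : ∀ k < K, Matches w (j + k) (window M x (t + M + (k : ℕ))) →
      x (t + M + (k : ℕ)) = w (j + k) := fun k hk hmk => by
    have := hx (M + k) (by omega)
    rw [show t + ((M + k : ℕ) : ℤ) = t + M + (k : ℕ) by push_cast; ring] at this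
    rw [this, steer_eq hL hLM hw (by omega) hmk]
  have hall : ∀ k ≤ K, Matches w (j + k) (window M x (t + M + (k : ℕ))) := by
    intro k
    induction k with
    | zero => intro _; simpa using hm
    | succ k ih =>
      intro hk
      have := (ih (by omega)).succ (hstep k (by omega) (ih (by omega)))
      rwa [show t + M + (k : ℤ) + 1 = t + M + ((k + 1 : ℕ) : ℤ) by push_cast; ring] at this
  exact fun k hk => hstep k hk (hall k hk.le)

end Steering

/-! ### Counting block occurrences, and extraction of a periodic sequence from a stationary law -/

lemma count_add_of_periodic (p : ℕ → Prop) [DecidablePred p] {L : ℕ}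
    (hp : ∀ i, p (i + L) ↔ p i) (j : ℕ) : Nat.count (fun i => p (j + i)) L = Nat.count p L := by
  have h1 := Nat.count_add p j L
  have h2 := Nat.count_add p L j
  have h3 : (fun i => p (L + i)) = p := funext fun i => by rw [add_comm, hp]
  simp only [h3] at h2
  rw [add_comm j L] at h1
  omega

section Averaging

variable {Ω : Type*} [MeasurableSpace Ω]

omit [MeasurableSpace Ω] in
open Classical in
lemma count_eq_sum_indicator (F : ℕ → Set Ω) (L : ℕ) (ω : Ω) :
    (Nat.count (fun i => ω ∈ F i) L : ENNReal) =
      ∑ i ∈ Finset.range L, (F i).indicator 1 ω := by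
  rw [Nat.count_eq_card_filter_range, Finset.card_filter]
  push_cast
  exact Finset.sum_congr rfl fun i _ => by simp [Set.indicator_apply]

open Classical in
lemma sum_measure_eq_lintegral_count (μ : Measure Ω) (F : ℕ → Set Ω)
    (hF : ∀ i, MeasurableSet (F i)) (L : ℕ) :
    ∑ i ∈ Finset.range L, μ (F i) = ∫⁻ ω, (Nat.count (fun i => ω ∈ F i) L : ENNReal) ∂μ := by
  simp only [count_eq_sum_indicator]
  rw [lintegral_finsetSum _ fun i _ => measurable_one.indicator (hF i)]
  exact Finset.sum_congr rfl fun i _ => (lintegral_indicator_one (hF i)).symm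

end Averaging

section Stationary

variable {A : Type*}

/-- The symbols at times `t, …, t + n - 1`. -/
def block (n : ℕ) (ω : ℤ → A) (t : ℤ) : Fin n → A := fun i => ω (t + (i : ℕ))

lemma sample_eq_block (n : ℕ) (ω : ℤ → A) : sample n ω = block n ω 1 := by
  funext i
  simp [sample, block, add_comm]

variable [MeasurableSpace A]

lemma measurable_block (n : ℕ) (t : ℤ) : Measurable fun ω : ℤ → A => block n ω t :=
  measurable_pi_lambda _ fun _ => measurable_pi_apply _

lemma measure_block_add {P : Measure (ℤ → A)} (hP : MeasurePreserving shift P P) {n : ℕ}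
    {D : Set (Fin n → A)} (hD : MeasurableSet D) (t : ℤ) (k : ℕ) :
    P {ω | block n ω (t + k) ∈ D} = P {ω | block n ω t ∈ D} := by
  rw [← (hP.iterate k).measure_preimage (s := {ω | block n ω t ∈ D}) (measurable_block n t hD).nullMeasurableSet]
  congr 1
  ext ω
  simp only [Set.mem_preimage, Set.mem_ofPred_eq, shift_iterate]
  change (fun i : Fin n => ω (t + k + (i : ℕ))) ∈ D ↔ (fun i : Fin n => ω (t + (i : ℕ) + k)) ∈ D
  simp only [add_right_comm t (k : ℤ)]

open Classical in
/-- A stationary law that rarely produces blocks in `D` admits a periodic sequence in which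
blocks in `D` are rare. -/
lemma exists_periodic_count_le {P : Measure (ℤ → A)} [IsProbabilityMeasure P]
    (hP : MeasurePreserving shift P P) {n : ℕ} {D : Set (Fin n → A)} (hD : MeasurableSet D)
    (L : ℕ) :
    ∃ w : ℕ → A, (∀ j, w (j + L) = w j) ∧
      (Nat.count (fun i => (fun r : Fin n => w (i + r)) ∈ D) L : ENNReal) ≤
        L * P {ω | block n ω 1 ∈ D} + n := by
  set F : ℕ → Set (ℤ → A) := fun i => {ω | block n ω (1 + i) ∈ D}
  have hF : ∀ i, MeasurableSet (F i) := fun i => measurable_block n _ hD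
  -- Some path visits `D` no more often than the average; its first `L` symbols are then repeated
  -- periodically.
  obtain ⟨ω, hω⟩ := exists_le_lintegral (μ := P)
    (f := fun ω => (Nat.count (fun i => ω ∈ F i) L : ENNReal)) (by
      simp only [count_eq_sum_indicator]
      exact (Finset.measurable_sum _ fun i _ => measurable_one.indicator (hF i)).aemeasurable)
  rw [← sum_measure_eq_lintegral_count P F hF L,
    Finset.sum_congr rfl fun i _ => measure_block_add hP hD 1 i, Finset.sum_const,
    Finset.card_range, nsmul_eq_mul] at hω
  refine ⟨fun i => ω (1 + ((i % L : ℕ) : ℤ)), fun j => by simp, ?_⟩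
  refine le_trans ?_ (add_le_add_left hω _)
  norm_cast
  simp only [Nat.count_eq_card_filter_range]
  -- Only the last `n` starting positions can give blocks that wrap around the period, which
  -- accounts for the error `n`.
  have hsub : (Finset.range L).filter
      (fun i => (fun r : Fin n => ω (1 + (((i + r) % L : ℕ) : ℤ))) ∈ D) ⊆
      (Finset.range L).filter (fun i => ω ∈ F i) ∪ Finset.Ico (L - n) L := by
    intro i hi
    simp only [Finset.mem_filter, Finset.mem_range, Finset.mem_union, Finset.mem_Ico] at hi ⊢
    by_cases hin : i + n ≤ L
    · left
      refine ⟨hi.1, ?_⟩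
      have hb : (fun r : Fin n => ω (1 + (((i + r) % L : ℕ) : ℤ))) = block n ω (1 + i) := by
        funext r
        have hr := r.2
        rw [Nat.mod_eq_of_lt (by omega), block]
        congr 1
        push_cast
        ring
      rw [hb] at hi
      exact hi.2
    · right
      omega
  refine (Finset.card_le_card hsub).trans ((Finset.card_union_le _ _).trans ?_)
  gcongr
  rw [Nat.card_Ico]
  omega

end Stationary

/-! ### Approximation by processes with finite context trees -/

section Approximation

variable {A : Type*} [Finite A]

/-- There is an innovation law charging everything, and `follow` almost fully. -/
lemma exists_innovation_law {δ : ENNReal} (hδ : δ ≠ 0) :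
    ∃ ν : Measure (Innovation A), IsProbabilityMeasure ν ∧ (∀ b, 0 < ν {b}) ∧
      ν {Innovation.follow}ᶜ ≤ δ := by
  have := Fintype.ofFinite (Innovation A)
  -- Truncation at `1` makes `1 - δ'` a genuine complementary weight despite truncated subtraction.
  set δ' := min δ 1
  have hδ' : δ' ≠ 0 := by simp [δ', hδ]
  have h1 : δ' ≤ 1 := min_le_right _ _
  set u : Measure (Innovation A) := (PMF.uniformOfFintype (Innovation A)).toMeasure
  refine ⟨(1 - δ') • Measure.dirac Innovation.follow + δ' • u, ⟨?_⟩, fun b => ?_, ?_⟩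
  · simp only [Measure.add_apply, Measure.smul_apply, measure_univ, smul_eq_mul, mul_one]
    exact tsub_add_cancel_of_le h1
  · rw [Measure.add_apply, Measure.smul_apply, Measure.smul_apply, smul_eq_mul, smul_eq_mul]
    refine pos_iff_ne_zero.2 fun h => ?_
    have h2 := (add_eq_zero.1 h).2
    rw [PMF.toMeasure_apply_singleton _ _ .of_discrete, PMF.uniformOfFintype_apply] at h2
    simp [hδ'] at h2
  · simp only [Measure.add_apply, Measure.smul_apply, smul_eq_mul]
    rw [Measure.dirac_apply' _ .of_discrete]
    simp only [Set.mem_compl_iff, Set.mem_singleton_iff, not_true_eq_false, not_false_eq_true,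
      Set.indicator_of_notMem, mul_zero, zero_add]
    exact (mul_le_mul_right prob_le_one δ').trans ((mul_one _).le.trans (min_le_left _ _))

variable [Nonempty A] [MeasurableSpace A] [DiscreteMeasurableSpace A]

omit [Finite A] [MeasurableSpace A] [DiscreteMeasurableSpace A] in
lemma process_eq_of_follow {M : ℕ} {f : (Fin M → A) → A} {ω : ℤ → Innovation A}
    (h : ∀ t, ∃ N, Coalesces (step f) ω t N) {t : ℤ} (ht : ω t = .follow) :
    process f ω t = f (window M (process f ω) t) := by
  rw [process_eq h, ht, nextSymbol]
  congr 1
  funext i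
  rw [stateAt_apply h, window, Fin.val_castSucc]

-- By stationarity the left side is the expected number of visits to `D` over `L` consecutive
-- starting times, taken after `M` steps of steering. If no instruction deviates during `M + (L +
-- n)` steps, these blocks run through exactly one period of `w`, with unknown phase. Otherwise each
-- of the `L` terms loses at most the probability of a deviation.
open Classical in
lemma chainLaw_steer_block_le {M L n : ℕ} (hL : 0 < L) (hLM : L ≤ M) {w : ℕ → A}
    (hw : ∀ j, w (j + L) = w j) (D : Set (Fin n → A)) (ν : Measure (Innovation A))
    [IsProbabilityMeasure ν] (hν : ∀ b, 0 < ν {b}) :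
    L * chainLaw (steer (M := M) w) ν {ω | block n ω 1 ∈ D} ≤
      Nat.count (fun i => (fun r : Fin n => w (i + r)) ∈ D) L +
        L * ((M + (L + n) : ℕ) * ν {Innovation.follow}ᶜ) := by
  set f := steer (M := M) w
  set μ := Measure.infinitePi fun _ : ℤ => ν
  have hD : MeasurableSet D := .of_discrete
  set F : ℕ → Set (ℤ → A) := fun i => {ω | block n ω (1 + (M + i : ℕ)) ∈ D}
  have hF : ∀ i, MeasurableSet (F i) := fun i => measurable_block n _ hD
  set c := Nat.count (fun i => (fun r : Fin n => w (i + r)) ∈ D) L with hc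
  set G : Set (ℤ → Innovation A) :=
    {ω | ∀ i ∈ Finset.range (M + (L + n)), ω (1 + (i : ℕ)) = .follow} with hG
  have hGm : MeasurableSet G := by
    have : G = ⋂ i ∈ Finset.range (M + (L + n)),
        (fun ω : ℤ → Innovation A => ω (1 + (i : ℕ))) ⁻¹' {Innovation.follow} := by
      ext ω
      simp [hG]
    rw [this]
    exact Finset.measurableSet_biInter _ fun i _ => measurable_pi_apply _ .of_discrete
  have hGc : μ Gᶜ ≤ (M + (L + n) : ℕ) * ν {Innovation.follow}ᶜ := by
    have : Gᶜ = ⋃ i ∈ Finset.range (M + (L + n)),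
        (fun ω : ℤ → Innovation A => ω (1 + (i : ℕ))) ⁻¹' {Innovation.follow}ᶜ := by
      ext ω
      simp [hG]
    rw [this]
    refine (measure_biUnion_finset_le _ _).trans ?_
    have h1 : ∀ i : ℕ, μ ((fun ω : ℤ → Innovation A => ω (1 + (i : ℕ))) ⁻¹'
        {Innovation.follow}ᶜ) = ν {Innovation.follow}ᶜ := fun i =>
      (measurePreserving_eval_infinitePi (fun _ : ℤ => ν) (1 + (i : ℕ))).measure_preimage
        MeasurableSet.of_discrete.nullMeasurableSet
    rw [Finset.sum_congr rfl fun i _ => h1 i]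
    simp
  have hcount : ∀ᵐ ω ∂μ,
      (Nat.count (fun i => ω ∈ process f ⁻¹' F i ∩ G) L : ENNReal) ≤ c := by
    filter_upwards [ae_process_coalesces f hν] with ω hco
    norm_cast
    by_cases hωG : ω ∈ G
    · obtain ⟨j, hj⟩ := exists_eq_of_follow hL hLM hw (x := process f ω) (t := 1) (L + n)
        fun i hi => process_eq_of_follow hco (hωG i (Finset.mem_range.2 hi))
      -- The phase `j` is irrelevant for a count over a full period.
      rw [hc, ← count_add_of_periodic (fun i => (fun r : Fin n => w (i + r)) ∈ D)
        (fun i => by simp only [add_right_comm i L, hw]) j]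
      simp only [Nat.count_eq_card_filter_range]
      refine Finset.card_le_card fun i hi => ?_
      simp only [Finset.mem_filter, Finset.mem_range] at hi ⊢
      refine ⟨hi.1, ?_⟩
      have hb : (fun r : Fin n => w (j + i + r)) = block n (process f ω) (1 + (M + i : ℕ)) := by
        funext r
        have hr := r.2
        rw [block, add_assoc, ← hj (i + r) (by omega)]
        congr 1
        push_cast
        ring
      rw [hb]
      exact hi.2.1
    · simp [hωG]
  have hstat := (chainLaw_mem_statErgodic f ν).2.toMeasurePreserving
  calc (L : ENNReal) * chainLaw f ν {ω | block n ω 1 ∈ D}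
      = ∑ i ∈ Finset.range L, μ (process f ⁻¹' F i) := by
        have h1 : ∀ i, μ (process f ⁻¹' F i) = chainLaw f ν {ω | block n ω 1 ∈ D} := fun i => by
          rw [← chainLaw_apply f ν (hF i)]
          exact measure_block_add hstat hD 1 (M + i)
        simp [h1]
    _ ≤ ∑ i ∈ Finset.range L, (μ (process f ⁻¹' F i ∩ G) + μ Gᶜ) :=
        Finset.sum_le_sum fun i _ =>
          (measure_le_inter_add_sdiff μ _ G).trans
            (add_le_add_right (measure_mono (Set.sdiff_subset_compl _ _)) _)
    _ = ∑ i ∈ Finset.range L, μ (process f ⁻¹' F i ∩ G) + L * μ Gᶜ := by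
        simp [Finset.sum_add_distrib]
    _ ≤ c + L * ((M + (L + n) : ℕ) * ν {Innovation.follow}ᶜ) := by
        refine add_le_add (?_ : _ ≤ (c : ENNReal)) (mul_le_mul_right hGc _)
        rw [sum_measure_eq_lintegral_count μ _
          fun i => (measurable_process f (hF i)).inter hGm]
        calc _ ≤ ∫⁻ _, (c : ENNReal) ∂μ := by
              refine lintegral_mono_ae ?_
              filter_upwards [hcount] with ω hω
              convert hω
          _ = c := by simp

/-- The sample law of a stationary process is approximable by processes with finite context
trees that contain all short strings as nodes. -/
theorem exists_statErgodicFinite_approx [Nontrivial A] {P : Measure (ℤ → A)}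
    [IsProbabilityMeasure P] (hP : MeasurePreserving shift P P) {n : ℕ} (D : Set (Fin n → A))
    (k : ℕ) {ε : ENNReal} (hε : ε ≠ 0) :
    ∃ Q ∈ statErgodicFinite A, (∀ u : List A, u.length ≤ k → u ∈ nodes (contextTree Q)) ∧
      Q {ω | sample n ω ∈ D} ≤ P {ω | sample n ω ∈ D} + ε := by
  simp only [sample_eq_block]
  have hε2 : ε / 2 ≠ 0 := by simp [hε]
  -- The period is long enough for the wrap-around error `n / L` to be at most `ε / 2`; the
  -- deviations will cost the other half.
  obtain ⟨L, hL⟩ := ENNReal.exists_nat_gt (ENNReal.div_ne_top (ENNReal.natCast_ne_top n) hε2)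
  have hL0 : 0 < L := by
    rw [← Nat.cast_pos (α := ENNReal)]
    exact pos_of_gt hL
  have hnL : (n : ENNReal) ≤ L * (ε / 2) :=
    (ENNReal.div_le_iff_le_mul (Or.inl hε2) (Or.inr (by simpa using hL0.ne'))).1 hL.le
  obtain ⟨w, hw, hcount⟩ := exists_periodic_count_le hP (D := D) .of_discrete L
  -- `M ≥ L` is needed for steering, `M ≥ k` for the nodes.
  set M := max L k
  have hN : ((M + (L + n) : ℕ) : ENNReal) ≠ 0 := by
    rw [Nat.cast_ne_zero]
    omega
  obtain ⟨ν, hprob, hν, hνδ⟩ := exists_innovation_law (A := A)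
    (δ := ε / 2 / (M + (L + n) : ℕ)) (ENNReal.div_ne_zero.2 ⟨hε2, ENNReal.natCast_ne_top _⟩)
  refine ⟨chainLaw (steer (M := M) w) ν, chainLaw_mem_statErgodicFinite _ hν,
    fun u hu => mem_nodes_contextTree_chainLaw _ hν u
      (hu.trans ((le_max_right L k).trans (Nat.le_succ _))), ?_⟩
  have hδ : ((M + (L + n) : ℕ) : ENNReal) * ν {Innovation.follow}ᶜ ≤ ε / 2 :=
    (mul_le_mul_right hνδ _).trans ENNReal.mul_div_le
  refine (ENNReal.mul_le_mul_iff_right (a := (L : ENNReal)) (by simpa using hL0.ne')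
    (ENNReal.natCast_ne_top L)).1 ?_
  refine (chainLaw_steer_block_le hL0 (le_max_left _ _) hw D ν hν).trans ?_
  calc _ ≤ (L * P {ω | block n ω 1 ∈ D} + L * (ε / 2)) + L * (ε / 2) :=
        add_le_add (hcount.trans (add_le_add_right hnL _)) (mul_le_mul_right hδ _)
    _ = L * (P {ω | block n ω 1 ∈ D} + ε) := by
        rw [add_assoc, ← mul_add, ENNReal.add_halves, ← mul_add]

end Approximation

end CT

/-! ### The main theorem -/

theorem theorem5 {A : Type*} [Finite A] [Nontrivial A] [MeasurableSpace A]
    [DiscreteMeasurableSpace A] (n : ℕ) (U : (Fin n → A) → CT.IrredTree A)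
    (hU : (⨆ P ∈ CT.statErgodic A,
      P {ω | CT.TreeLT (U (CT.sample n ω)).leaves (CT.fullTree A)}) = 1) :
    (⨅ P ∈ CT.statErgodic A,
      P {ω | CT.TreeLE (CT.contextTree P) (U (CT.sample n ω)).leaves}) = 0 ∧
    (⨅ P ∈ CT.statErgodicFinite A,
      P {ω | CT.TreeLE (CT.contextTree P) (U (CT.sample n ω)).leaves}) = 0 := by
  set D : Set (Fin n → A) := {x | ¬ CT.TreeLT (U x).leaves (CT.fullTree A)} with hD
  have hmiss : ∀ x, ∃ u : List A, x ∉ D → u ∉ CT.nodes (U x).leaves := fun x => by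
    by_cases hx : x ∈ D
    -- A dummy string: nothing is required of sample values in `D`.
    · exact ⟨[], fun h => absurd hx h⟩
    · obtain ⟨u, -, hu⟩ := Set.exists_of_ssubset (not_not.1 hx)
      exact ⟨u, fun _ => hu⟩
  choose u hu using hmiss
  obtain ⟨k, hk⟩ : ∃ k, ∀ x, (u x).length ≤ k := by
    have := Fintype.ofFinite (Fin n → A)
    exact ⟨Finset.univ.sup fun x => (u x).length,
      fun x => Finset.le_sup (f := fun x => (u x).length) (Finset.mem_univ x)⟩
  have key : ∀ ε : ENNReal, ε ≠ 0 → ∃ Q ∈ CT.statErgodicFinite A,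
      Q {ω | CT.TreeLE (CT.contextTree Q) (U (CT.sample n ω)).leaves} ≤ ε := by
    intro ε hε
    have hε2 : ε / 2 ≠ 0 := by simp [hε]
    have hlt : 1 - ε / 2 < ⨆ P ∈ CT.statErgodic A,
        P {ω | CT.TreeLT (U (CT.sample n ω)).leaves (CT.fullTree A)} := by
      rw [hU]
      exact ENNReal.sub_lt_self ENNReal.one_ne_top one_ne_zero hε2
    obtain ⟨P, hP, hPlt⟩ := lt_biSup_iff.1 hlt
    have := hP.1
    have hmeas : MeasurableSet {ω : ℤ → A | CT.sample n ω ∈ D} := by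
      simp only [CT.sample_eq_block]
      exact CT.measurable_block n 1 .of_discrete
    have hPD : P {ω | CT.sample n ω ∈ D} ≤ ε / 2 := by
      have hc : {ω : ℤ → A | CT.TreeLT (U (CT.sample n ω)).leaves (CT.fullTree A)} =
          {ω | CT.sample n ω ∈ D}ᶜ := by
        ext ω
        simp [hD]
      rw [hc, prob_compl_eq_one_sub hmeas] at hPlt
      exact not_lt.1 fun h => hPlt.not_ge (tsub_le_tsub_left h.le 1)
    obtain ⟨Q, hQ, hnodes, hQD⟩ :=
      CT.exists_statErgodicFinite_approx hP.2.toMeasurePreserving D k hε2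
    refine ⟨Q, hQ, ?_⟩
    refine le_trans (measure_mono fun ω hω => ?_)
      (hQD.trans ((add_le_add_left hPD _).trans (ENNReal.add_halves ε).le))
    -- Outside `D` the string `u` of the sample is a node of the context tree of `Q` but not of `U`.
    by_contra hωD
    exact hu _ hωD (hω (hnodes _ (hk _)))
  constructor
  · refine nonpos_iff_eq_zero.1 (le_of_forall_gt fun ε hε => ?_)
    obtain ⟨ε', h0, h1⟩ := exists_between hε
    obtain ⟨Q, hQ, hle⟩ := key ε' h0.ne'
    exact ((iInf₂_le Q hQ.1).trans hle).trans_lt h1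
  · refine nonpos_iff_eq_zero.1 (le_of_forall_gt fun ε hε => ?_)
    obtain ⟨ε', h0, h1⟩ := exists_between hε
    obtain ⟨Q, hQ, hle⟩ := key ε' h0.ne'
    exact ((iInf₂_le Q hQ).trans hle).trans_lt h1
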